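/- Let $(\mathfrak g,J,\omega)$ be a four-dimensional real Kähler Lie algebra, that is: $\mathfrak g$ is a real Lie algebra of dimension $4$; $J:\mathfrak g\to\mathfrak g$ is linear with $J^2=-I$ and $[Jx,Jy]-[x,y]-J[Jx,y]-J[x,Jy]=0$ for all $x,y\in\mathfrak g$; and $\omega$ is a non-degenerate alternating bilinear form on $\mathfrak g$ that is closed, $\omega([x,y],z)+\omega([y,z],x)+\omega([z,x],y)=0$, and satisfies $\omega(Jx,Jy)=\omega(x,y)$. Let $g(x,y)=\omega(Jx,y)$ be the associated, possibly indefinite, pseudo-Riemannian metric. Assume that there is an abelian ideal $\mathfrak h$ of $\mathfrak g$ such that $J\mathfrak h$ is a Lie subalgebra and there is a split short exact sequence of Lie algebras $$0\longrightarrow\mathfrak h\longrightarrow\mathfrak g\longrightarrow J\mathfrak h\longrightarrow 0,$$ in which $\mathfrak h\to\mathfrak g$ is the inclusion and the splitting is the inclusion $J\mathfrak h\to\mathfrak g$, and such that the resulting sum $\mathfrak g=\mathfrak h\oplus J\mathfrak h$ is orthogonal with respect to $g$. Then $\mathfrak g$ is isomorphic, as a real Lie algebra, to one of $$\mathbb R^4,\quad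 \mathbb R\times\mathfrak h_3,\quad \mathbb R^2\times\mathfrak{aff}(\mathbb R),\quad \mathfrak{aff}(\mathbb C),\quad \mathfrak{aff}(\mathbb R)\times\mathfrak{aff}(\mathbb R),\quad \mathfrak r_{4,-1,-1},\quad \mathfrak d_{4,1},\quad \mathfrak d_{4,2},\quad \mathfrak d_{4,1/2}.$$ Here $\mathbb R^n$ is abelian; $\mathfrak h_3$ is the Heisenberg Lie algebra with basis $e_1,e_2,e_3$ and $[e_1,e_2]=e_3$; for $A=\mathbb R$ or $\mathbb C$, $\mathfrak{aff}(A)$ is the real Lie algebra $A\oplus A$ with $[(a,b),(c,d)]=(0,ad-cb)$; $\mathfrak r_{4,\alpha,\beta}$ has a basis $e_1,\dots,e_4$ with $[e_4,e_1]=e_1$, $[e_4,e_2]=\alpha e_2$, $[e_4,e_3]=\beta e_3$; and $\mathfrak d_{4,\lambda}$ has a basis $e_1,\dots,e_4$ with $[e_1,e_2]=e_3$, $[e_4,e_3]=e_3$, $[e_4,e_1]=\lambda e_1$, $[e_4,e_2]=(1-\lambda)e_2$ (in each case the brackets of basis vectors not determined by these through antisymmetry vanish). -/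

import Mathlib

/-- A Kähler structure `(J, ω)` on a real Lie algebra: an integrable almost complex structure `J`
together with a compatible symplectic form `ω`. -/
structure KahlerStructure (L : Type*) [LieRing L] [LieAlgebra ℝ L] where
  /-- the complex structure -/
  J : L →ₗ[ℝ] L
  /-- the symplectic form -/
  ω : LinearMap.BilinForm ℝ L
  J_sq : ∀ x, J (J x) = -x
  /-- vanishing of the Nijenhuis tensor -/
  integrable : ∀ x y, ⁅J x, J y⁆ - ⁅x, y⁆ - J ⁅J x, y⁆ - J ⁅x, J y⁆ = 0
  alt : ω.IsAlt
  nondegenerate : ω.Nondegenerate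
  closed : ∀ x y z, ω ⁅x, y⁆ z + ω ⁅y, z⁆ x + ω ⁅z, x⁆ y = 0
  compatible : ∀ x y, ω (J x) (J y) = ω x y

/-- The pseudo-Riemannian metric `g(x, y) = ω(J x, y)` of a Kähler structure. -/
def KahlerStructure.metric {L : Type*} [LieRing L] [LieAlgebra ℝ L] (K : KahlerStructure L) :
    LinearMap.BilinForm ℝ L :=
  K.ω ∘ₗ K.J

/-- The ideal `h` gives a split short exact sequence of Lie algebras `0 → h → L → J h → 0` whose
sum `L = h ⊕ J h` is orthogonal: `J h` is a Lie subalgebra `k` of `L`, there is a homomorphism of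
Lie algebras `π : L → k` which makes the sequence exact, the inclusion of `k` in `L` is a section
of `π`, and `h` is orthogonal to `k` for the metric. -/
def KahlerStructure.IsOrthogonalSplit {L : Type*} [LieRing L] [LieAlgebra ℝ L]
    (K : KahlerStructure L) (h : LieIdeal ℝ L) : Prop :=
  ∃ k : LieSubalgebra ℝ L,
    k.toSubmodule = h.toSubmodule.map K.J ∧
    (∃ π : L →ₗ⁅ℝ⁆ k, LieAlgebra.IsExtension h.incl π ∧ π.comp k.incl = LieHom.id) ∧
    ∀ x ∈ h, ∀ y ∈ k, K.metric x y = 0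

/-- The abelian Lie algebra `ℝⁿ`. -/
def AbelianLie (n : ℕ) : Type := Fin n → ℝ

namespace AbelianLie

noncomputable instance (n : ℕ) : AddCommGroup (AbelianLie n) :=
  inferInstanceAs (AddCommGroup (Fin n → ℝ))

noncomputable instance (n : ℕ) : Module ℝ (AbelianLie n) :=
  inferInstanceAs (Module ℝ (Fin n → ℝ))

noncomputable instance (n : ℕ) : LieRing (AbelianLie n) where
  bracket _ _ := 0
  add_lie _ _ _ := (add_zero 0).symm
  lie_add _ _ _ := (add_zero 0).symm
  lie_self _ := rfl
  leibniz_lie _ _ _ := (add_zero 0).symm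

noncomputable instance (n : ℕ) : LieAlgebra ℝ (AbelianLie n) where
  lie_smul t _ _ := (smul_zero t).symm

end AbelianLie

/-- The real Lie algebra `aff(A)` of a commutative real algebra `A`: the space `A × A` with
`[(a, b), (c, d)] = (0, a d - c b)`. For `A = ℝ` it is the Lie algebra of the group of affine
motions of the line, for `A = ℂ` the real Lie algebra underlying that of the affine motions of
the complex line. -/
def Aff (A : Type) : Type := A × A

namespace Aff

variable (A : Type) [CommRing A] [Algebra ℝ A]

instance : AddCommGroup (Aff A) := inferInstanceAs (AddCommGroup (A × A))

instance : Module ℝ (Aff A) := inferInstanceAs (Module ℝ (A × A))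

instance : LieRing (Aff A) where
  bracket x y := ((0, x.1 * y.2 - y.1 * x.2) : A × A)
  add_lie x y z := Prod.ext (add_zero (0 : A)).symm
    (show (x.1 + y.1) * z.2 - z.1 * (x.2 + y.2) = (x.1 * z.2 - z.1 * x.2) +
      (y.1 * z.2 - z.1 * y.2) by ring)
  lie_add x y z := Prod.ext (add_zero (0 : A)).symm
    (show x.1 * (y.2 + z.2) - (y.1 + z.1) * x.2 = (x.1 * y.2 - y.1 * x.2) +
      (x.1 * z.2 - z.1 * x.2) by ring)
  lie_self x := Prod.ext rfl (sub_self (x.1 * x.2))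
  leibniz_lie x y z := Prod.ext (add_zero (0 : A)).symm
    (show x.1 * (y.1 * z.2 - z.1 * y.2) - 0 * x.2 =
      (0 * z.2 - z.1 * (x.1 * y.2 - y.1 * x.2)) + (y.1 * (x.1 * z.2 - z.1 * x.2) - 0 * y.2) by
      ring)

instance : LieAlgebra ℝ (Aff A) where
  lie_smul t x y := Prod.ext (smul_zero t).symm
    (show x.1 * (t • y.2) - (t • y.1) * x.2 = t • (x.1 * y.2 - y.1 * x.2) by
      rw [mul_smul_comm, smul_mul_assoc, smul_sub])

end Aff

/-- The three-dimensional Heisenberg Lie algebra `h₃`, in coordinates for a basis `e₁, e₂, e₃`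
with `[e₁, e₂] = e₃`. -/
def Heis3 : Type := Fin 3 → ℝ

namespace Heis3

noncomputable instance : AddCommGroup Heis3 := inferInstanceAs (AddCommGroup (Fin 3 → ℝ))

noncomputable instance : Module ℝ Heis3 := inferInstanceAs (Module ℝ (Fin 3 → ℝ))

/-- The bracket of `h₃`. -/
def bracket (x y : Fin 3 → ℝ) : Fin 3 → ℝ := ![0, 0, x 0 * y 1 - x 1 * y 0]

theorem add_bracket (x y z : Fin 3 → ℝ) :
    bracket (x + y) z = bracket x z + bracket y z := by
  ext i; fin_cases i <;> simp [bracket] <;> ring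

theorem bracket_add (x y z : Fin 3 → ℝ) :
    bracket x (y + z) = bracket x y + bracket x z := by
  ext i; fin_cases i <;> simp [bracket] <;> ring

theorem bracket_self (x : Fin 3 → ℝ) : bracket x x = 0 := by
  ext i; fin_cases i <;> simp [bracket]; ring

theorem bracket_leibniz (x y z : Fin 3 → ℝ) :
    bracket x (bracket y z) = bracket (bracket x y) z + bracket y (bracket x z) := by
  ext i; fin_cases i <;> simp [bracket]

theorem bracket_smul (t : ℝ) (x y : Fin 3 → ℝ) :
    bracket x (t • y) = t • bracket x y := by
  ext i; fin_cases i <;> simp [bracket] <;> ring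

noncomputable instance : LieRing Heis3 where
  bracket := bracket
  add_lie := add_bracket
  lie_add := bracket_add
  lie_self := bracket_self
  leibniz_lie := bracket_leibniz

noncomputable instance : LieAlgebra ℝ Heis3 where
  lie_smul := bracket_smul

end Heis3

/-- The Lie algebra `r_{4,α,β}`, in coordinates for a basis `e₁, e₂, e₃, e₄` with
`[e₄, e₁] = e₁`, `[e₄, e₂] = α e₂`, `[e₄, e₃] = β e₃`. -/
def LieR4 (_α _β : ℝ) : Type := Fin 4 → ℝ

namespace LieR4

variable (α β : ℝ)

noncomputable instance : AddCommGroup (LieR4 α β) := inferInstanceAs (AddCommGroup (Fin 4 → ℝ))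

noncomputable instance : Module ℝ (LieR4 α β) := inferInstanceAs (Module ℝ (Fin 4 → ℝ))

/-- The bracket of `r_{4,α,β}`. -/
def bracket (x y : Fin 4 → ℝ) : Fin 4 → ℝ :=
  ![x 3 * y 0 - x 0 * y 3, α * (x 3 * y 1 - x 1 * y 3), β * (x 3 * y 2 - x 2 * y 3), 0]

theorem add_bracket (x y z : Fin 4 → ℝ) :
    bracket α β (x + y) z = bracket α β x z + bracket α β y z := by
  ext i; fin_cases i <;> simp [bracket] <;> ring

theorem bracket_add (x y z : Fin 4 → ℝ) :
    bracket α β x (y + z) = bracket α β x y + bracket α β x z := by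
  ext i; fin_cases i <;> simp [bracket] <;> ring

theorem bracket_self (x : Fin 4 → ℝ) : bracket α β x x = 0 := by
  ext i; fin_cases i <;> simp [bracket] <;> ring_nf <;> simp

theorem bracket_leibniz (x y z : Fin 4 → ℝ) :
    bracket α β x (bracket α β y z) = bracket α β (bracket α β x y) z + bracket α β y (bracket α β x z) := by
  ext i; fin_cases i <;> simp [bracket] <;> ring

theorem bracket_smul (t : ℝ) (x y : Fin 4 → ℝ) :
    bracket α β x (t • y) = t • bracket α β x y := by
  ext i; fin_cases i <;> simp [bracket] <;> ring

noncomputable instance : LieRing (LieR4 α β) where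
  bracket := bracket α β
  add_lie := add_bracket α β
  lie_add := bracket_add α β
  lie_self := bracket_self α β
  leibniz_lie := bracket_leibniz α β

noncomputable instance : LieAlgebra ℝ (LieR4 α β) where
  lie_smul := bracket_smul α β

end LieR4

/-- The Lie algebra `d_{4,c}`, in coordinates for a basis `e₁, e₂, e₃, e₄` with
`[e₁, e₂] = e₃`, `[e₄, e₃] = e₃`, `[e₄, e₁] = c e₁`, `[e₄, e₂] = (1 - c) e₂`. -/
def LieD4 (_c : ℝ) : Type := Fin 4 → ℝ

namespace LieD4

variable (c : ℝ)

noncomputable instance : AddCommGroup (LieD4 c) := inferInstanceAs (AddCommGroup (Fin 4 → ℝ))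

noncomputable instance : Module ℝ (LieD4 c) := inferInstanceAs (Module ℝ (Fin 4 → ℝ))

/-- The bracket of `d_{4,c}`. -/
def bracket (x y : Fin 4 → ℝ) : Fin 4 → ℝ :=
  ![c * (x 3 * y 0 - x 0 * y 3), (1 - c) * (x 3 * y 1 - x 1 * y 3),
    (x 0 * y 1 - x 1 * y 0) + (x 3 * y 2 - x 2 * y 3), 0]

theorem add_bracket (x y z : Fin 4 → ℝ) :
    bracket c (x + y) z = bracket c x z + bracket c y z := by
  ext i; fin_cases i <;> simp [bracket] <;> ring

theorem bracket_add (x y z : Fin 4 → ℝ) :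
    bracket c x (y + z) = bracket c x y + bracket c x z := by
  ext i; fin_cases i <;> simp [bracket] <;> ring

theorem bracket_self (x : Fin 4 → ℝ) : bracket c x x = 0 := by
  ext i; fin_cases i <;> simp [bracket] <;> ring_nf <;> simp

theorem bracket_leibniz (x y z : Fin 4 → ℝ) :
    bracket c x (bracket c y z) = bracket c (bracket c x y) z + bracket c y (bracket c x z) := by
  ext i; fin_cases i <;> simp [bracket] <;> ring

theorem bracket_smul (t : ℝ) (x y : Fin 4 → ℝ) :
    bracket c x (t • y) = t • bracket c x y := by
  ext i; fin_cases i <;> simp [bracket] <;> ring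

noncomputable instance : LieRing (LieD4 c) where
  bracket := bracket c
  add_lie := add_bracket c
  lie_add := bracket_add c
  lie_self := bracket_self c
  leibniz_lie := bracket_leibniz c

noncomputable instance : LieAlgebra ℝ (LieD4 c) where
  lie_smul := bracket_smul c

end LieD4

/-! Orthogonality of `h` and `J h` says that `h` is Lagrangian, so all the structure of the Lie
algebra sits on the plane `h` with its product x * y = [Jx, y]. The vanishing Nijenhuis tensor gives
[Jx, Jy] = J(x * y - y * x), hence the product determines the bracket; the Jacobi identity makes it
left-symmetric, and closedness of ω becomes the Codazzi equation for the metric on `h`, which is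
nondegenerate.

If the product is commutative it is associative, and the two-dimensional commutative associative
real algebras can be listed: zero product, nilpotent, ℝ plus a null line, ℂ, ℝ × ℝ, dual numbers
(`nonempty_lieEquiv_of_commutative`). The metric plays no role here.

Otherwise `exists_affine_pair` gives x, y with x * y - y * x = y. Write L_x, L_y for left
multiplications. Then [L_x, L_y] = L_y, so L_y is nilpotent, and there are three cases: L_y = 0; L_y
nonzero with L_y y = 0; L_y y nonzero. In the first two the Codazzi equation fixes the remaining
eigenvalue of L_x and yields r_{4,-1,-1} and d_{4,2}; in the third the Jacobi identity alone yields
d_{4,1/2}. -/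

/-- The bracket of two vectors given by their coordinates with respect to four vectors. -/
theorem lie_sum_fin_four {L : Type*} [LieRing L] [LieAlgebra ℝ L] (v : Fin 4 → L)
    (p q : Fin 4 → ℝ) :
    ⁅∑ i, p i • v i, ∑ i, q i • v i⁆ =
      (p 0 * q 1 - p 1 * q 0) • ⁅v 0, v 1⁆ + (p 0 * q 2 - p 2 * q 0) • ⁅v 0, v 2⁆ +
      (p 0 * q 3 - p 3 * q 0) • ⁅v 0, v 3⁆ + (p 1 * q 2 - p 2 * q 1) • ⁅v 1, v 2⁆ +
      (p 1 * q 3 - p 3 * q 1) • ⁅v 1, v 3⁆ + (p 2 * q 3 - p 3 * q 2) • ⁅v 2, v 3⁆ := by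
  simp only [Fin.sum_univ_four, lie_add, add_lie, lie_smul, smul_lie, lie_self]
  rw [← lie_skew (v 1) (v 0), ← lie_skew (v 2) (v 0), ← lie_skew (v 3) (v 0),
    ← lie_skew (v 2) (v 1), ← lie_skew (v 3) (v 1), ← lie_skew (v 3) (v 2)]
  module

/-- A Lie algebra is isomorphic to a model with four coordinates as soon as it has a basis whose
brackets are those of the model. -/
theorem nonempty_lieEquiv_of_frame {L M : Type*} [LieRing L] [LieAlgebra ℝ L] [LieRing M]
    [LieAlgebra ℝ M] (hdim : Module.finrank ℝ L = 4) (φ : M ≃ₗ[ℝ] (Fin 4 → ℝ)) (v : Fin 4 → L)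
    (hv : LinearIndependent ℝ v)
    (H : ∀ p q : M, ⁅∑ i, φ p i • v i, ∑ i, φ q i • v i⁆ = ∑ i, φ ⁅p, q⁆ i • v i) :
    Nonempty (L ≃ₗ⁅ℝ⁆ M) := by
  let b := basisOfLinearIndependentOfCardEqFinrank hv (by simp [hdim])
  have hb : ⇑b = v := coe_basisOfLinearIndependentOfCardEqFinrank hv _
  let e : M ≃ₗ[ℝ] L := φ.trans b.equivFun.symm
  have he : ∀ p, e p = ∑ i, φ p i • v i := fun p => by
    simp [e, Module.Basis.equivFun_symm_apply, hb]
  refine ⟨LieEquiv.symm { e with map_lie' := ?_ }⟩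
  intro p q
  change e ⁅p, q⁆ = ⁅e p, e q⁆
  rw [he, he, he, H]

/-! ### Recognition of each model from the brackets of a basis -/

section Models

variable {L : Type*} [LieRing L] [LieAlgebra ℝ L] {a b c d : L}

theorem nonempty_lieEquiv_abelianLie (hdim : Module.finrank ℝ L = 4)
    (hv : LinearIndependent ℝ ![a, b, c, d]) (hab : ⁅a, b⁆ = 0) (hac : ⁅a, c⁆ = 0)
    (had : ⁅a, d⁆ = 0) (hbc : ⁅b, c⁆ = 0) (hbd : ⁅b, d⁆ = 0) (hcd : ⁅c, d⁆ = 0) :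
    Nonempty (L ≃ₗ⁅ℝ⁆ AbelianLie 4) := by
  refine nonempty_lieEquiv_of_frame hdim
    (show AbelianLie 4 ≃ₗ[ℝ] (Fin 4 → ℝ) from LinearEquiv.refl ℝ (Fin 4 → ℝ)) _ hv fun p q => ?_
  rw [lie_sum_fin_four]
  change _ = ∑ i, (0 : Fin 4 → ℝ) i • ![a, b, c, d] i
  simp [hab, hac, had, hbc, hbd, hcd]

theorem nonempty_lieEquiv_abelianLie_prod_heis3 (hdim : Module.finrank ℝ L = 4)
    (hv : LinearIndependent ℝ ![a, b, c, d]) (hab : ⁅a, b⁆ = 0) (hac : ⁅a, c⁆ = 0)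
    (had : ⁅a, d⁆ = 0) (hbc : ⁅b, c⁆ = d) (hbd : ⁅b, d⁆ = 0) (hcd : ⁅c, d⁆ = 0) :
    Nonempty (L ≃ₗ⁅ℝ⁆ (AbelianLie 1 × Heis3)) := by
  let φ : (AbelianLie 1 × Heis3) ≃ₗ[ℝ] (Fin 4 → ℝ) :=
    { toFun := fun p => ![p.1 0, p.2 0, p.2 1, p.2 2]
      map_add' := fun p q => by ext i; fin_cases i <;> rfl
      map_smul' := fun t p => by ext i; fin_cases i <;> rfl
      invFun := fun f => (![f 0], ![f 1, f 2, f 3])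
      left_inv := fun p => Prod.ext (by funext i; fin_cases i; rfl)
        (by funext i; fin_cases i <;> rfl)
      right_inv := fun f => by ext i; fin_cases i <;> rfl }
  have hφ : ∀ p, φ p = ![p.1 0, p.2 0, p.2 1, p.2 2] := fun _ => rfl
  refine nonempty_lieEquiv_of_frame hdim φ _ hv fun p q => ?_
  have hpq : φ ⁅p, q⁆ = ![0, 0, 0, p.2 0 * q.2 1 - p.2 1 * q.2 0] := rfl
  rw [lie_sum_fin_four, hpq, hφ, hφ]
  simp [Fin.sum_univ_four, hab, hac, had, hbc, hbd, hcd]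

theorem nonempty_lieEquiv_abelianLie_prod_aff (hdim : Module.finrank ℝ L = 4)
    (hv : LinearIndependent ℝ ![a, b, c, d]) (hab : ⁅a, b⁆ = 0) (hac : ⁅a, c⁆ = 0)
    (had : ⁅a, d⁆ = 0) (hbc : ⁅b, c⁆ = 0) (hbd : ⁅b, d⁆ = 0) (hcd : ⁅c, d⁆ = d) :
    Nonempty (L ≃ₗ⁅ℝ⁆ (AbelianLie 2 × Aff ℝ)) := by
  let φ : (AbelianLie 2 × Aff ℝ) ≃ₗ[ℝ] (Fin 4 → ℝ) :=
    { toFun := fun p => ![p.1 0, p.1 1, p.2.1, p.2.2]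
      map_add' := fun p q => by ext i; fin_cases i <;> rfl
      map_smul' := fun t p => by ext i; fin_cases i <;> rfl
      invFun := fun f => (![f 0, f 1], (f 2, f 3))
      left_inv := fun p => Prod.ext (by funext i; fin_cases i <;> rfl) rfl
      right_inv := fun f => by ext i; fin_cases i <;> rfl }
  have hφ : ∀ p, φ p = ![p.1 0, p.1 1, p.2.1, p.2.2] := fun _ => rfl
  refine nonempty_lieEquiv_of_frame hdim φ _ hv fun p q => ?_
  have hpq : φ ⁅p, q⁆ = ![0, 0, 0, p.2.1 * q.2.2 - q.2.1 * p.2.2] := rfl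
  rw [lie_sum_fin_four, hpq, hφ, hφ]
  simp [Fin.sum_univ_four, hab, hac, had, hbc, hbd, hcd]
  module

theorem nonempty_lieEquiv_aff_prod_aff (hdim : Module.finrank ℝ L = 4)
    (hv : LinearIndependent ℝ ![a, b, c, d]) (hab : ⁅a, b⁆ = b) (hac : ⁅a, c⁆ = 0)
    (had : ⁅a, d⁆ = 0) (hbc : ⁅b, c⁆ = 0) (hbd : ⁅b, d⁆ = 0) (hcd : ⁅c, d⁆ = d) :
    Nonempty (L ≃ₗ⁅ℝ⁆ (Aff ℝ × Aff ℝ)) := by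
  let φ : (Aff ℝ × Aff ℝ) ≃ₗ[ℝ] (Fin 4 → ℝ) :=
    { toFun := fun p => ![p.1.1, p.1.2, p.2.1, p.2.2]
      map_add' := fun p q => by ext i; fin_cases i <;> rfl
      map_smul' := fun t p => by ext i; fin_cases i <;> rfl
      invFun := fun f => ((f 0, f 1), (f 2, f 3))
      left_inv := fun p => rfl
      right_inv := fun f => by ext i; fin_cases i <;> rfl }
  have hφ : ∀ p, φ p = ![p.1.1, p.1.2, p.2.1, p.2.2] := fun _ => rfl
  refine nonempty_lieEquiv_of_frame hdim φ _ hv fun p q => ?_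
  have hpq : φ ⁅p, q⁆ =
      ![0, p.1.1 * q.1.2 - q.1.1 * p.1.2, 0, p.2.1 * q.2.2 - q.2.1 * p.2.2] := rfl
  rw [lie_sum_fin_four, hpq, hφ, hφ]
  simp [Fin.sum_univ_four, hab, hac, had, hbc, hbd, hcd]
  module

theorem nonempty_lieEquiv_aff_complex (hdim : Module.finrank ℝ L = 4)
    (hv : LinearIndependent ℝ ![a, b, c, d]) (hab : ⁅a, b⁆ = 0) (hac : ⁅a, c⁆ = c)
    (had : ⁅a, d⁆ = d) (hbc : ⁅b, c⁆ = d) (hbd : ⁅b, d⁆ = -c) (hcd : ⁅c, d⁆ = 0) :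
    Nonempty (L ≃ₗ⁅ℝ⁆ Aff ℂ) := by
  let φ : Aff ℂ ≃ₗ[ℝ] (Fin 4 → ℝ) :=
    { toFun := fun p => ![p.1.re, p.1.im, p.2.re, p.2.im]
      map_add' := fun p q => by ext i; fin_cases i <;> rfl
      map_smul' := fun t p => by
        have h1 : (t • p).1 = t • p.1 := rfl
        have h2 : (t • p).2 = t • p.2 := rfl
        ext i; fin_cases i <;> simp [h1, h2]
      invFun := fun f => (⟨f 0, f 1⟩, ⟨f 2, f 3⟩)
      left_inv := fun p => rfl
      right_inv := fun f => by ext i; fin_cases i <;> rfl }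
  have hφ : ∀ p, φ p = ![p.1.re, p.1.im, p.2.re, p.2.im] := fun _ => rfl
  refine nonempty_lieEquiv_of_frame hdim φ _ hv fun p q => ?_
  have hpq : φ ⁅p, q⁆ =
      ![0, 0, (p.1 * q.2 - q.1 * p.2).re, (p.1 * q.2 - q.1 * p.2).im] := rfl
  rw [lie_sum_fin_four, hpq, hφ, hφ]
  simp [Fin.sum_univ_four, hab, hac, had, hbc, hbd, hcd]
  module

theorem nonempty_lieEquiv_lieR4 {α β : ℝ} (hdim : Module.finrank ℝ L = 4)
    (hv : LinearIndependent ℝ ![a, b, c, d]) (hab : ⁅a, b⁆ = 0) (hac : ⁅a, c⁆ = 0)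
    (hda : ⁅d, a⁆ = a) (hbc : ⁅b, c⁆ = 0) (hdb : ⁅d, b⁆ = α • b) (hdc : ⁅d, c⁆ = β • c) :
    Nonempty (L ≃ₗ⁅ℝ⁆ LieR4 α β) := by
  refine nonempty_lieEquiv_of_frame hdim
    (show LieR4 α β ≃ₗ[ℝ] (Fin 4 → ℝ) from LinearEquiv.refl ℝ (Fin 4 → ℝ)) _ hv fun p q => ?_
  rw [lie_sum_fin_four]
  change _ = ∑ i, LieR4.bracket α β p q i • ![a, b, c, d] i
  change (p 0 * q 1 - p 1 * q 0) • ⁅a, b⁆ + (p 0 * q 2 - p 2 * q 0) • ⁅a, c⁆ +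
      (p 0 * q 3 - p 3 * q 0) • ⁅a, d⁆ + (p 1 * q 2 - p 2 * q 1) • ⁅b, c⁆ +
      (p 1 * q 3 - p 3 * q 1) • ⁅b, d⁆ + (p 2 * q 3 - p 3 * q 2) • ⁅c, d⁆ = _
  rw [← lie_skew a d, ← lie_skew b d, ← lie_skew c d, hab, hac, hda, hbc, hdb, hdc]
  simp [Fin.sum_univ_four, LieR4.bracket]
  module

theorem nonempty_lieEquiv_lieD4 {t : ℝ} (hdim : Module.finrank ℝ L = 4)
    (hv : LinearIndependent ℝ ![a, b, c, d]) (hab : ⁅a, b⁆ = c) (hac : ⁅a, c⁆ = 0)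
    (hda : ⁅d, a⁆ = t • a) (hbc : ⁅b, c⁆ = 0) (hdb : ⁅d, b⁆ = (1 - t) • b) (hdc : ⁅d, c⁆ = c) :
    Nonempty (L ≃ₗ⁅ℝ⁆ LieD4 t) := by
  refine nonempty_lieEquiv_of_frame hdim
    (show LieD4 t ≃ₗ[ℝ] (Fin 4 → ℝ) from LinearEquiv.refl ℝ (Fin 4 → ℝ)) _ hv fun p q => ?_
  rw [lie_sum_fin_four]
  change _ = ∑ i, LieD4.bracket t p q i • ![a, b, c, d] i
  change (p 0 * q 1 - p 1 * q 0) • ⁅a, b⁆ + (p 0 * q 2 - p 2 * q 0) • ⁅a, c⁆ +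
      (p 0 * q 3 - p 3 * q 0) • ⁅a, d⁆ + (p 1 * q 2 - p 2 * q 1) • ⁅b, c⁆ +
      (p 1 * q 3 - p 3 * q 1) • ⁅b, d⁆ + (p 2 * q 3 - p 3 * q 2) • ⁅c, d⁆ = _
  rw [← lie_skew a d, ← lie_skew b d, ← lie_skew c d, hab, hac, hda, hbc, hdb, hdc]
  simp [Fin.sum_univ_four, LieD4.bracket]
  module

end Models

section Independence

variable {V : Type*} [AddCommGroup V] [Module ℝ V]

theorem linearIndependent_four_iff {a b c d : V} :
    LinearIndependent ℝ ![a, b, c, d] ↔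
      ∀ p q r s : ℝ, p • a + q • b + r • c + s • d = 0 → p = 0 ∧ q = 0 ∧ r = 0 ∧ s = 0 := by
  rw [Fintype.linearIndependent_iff]
  constructor
  · intro H p q r s h
    have := H ![p, q, r, s] (by simpa [Fin.sum_univ_four] using h)
    exact ⟨this 0, this 1, this 2, this 3⟩
  · intro H f h
    obtain ⟨h0, h1, h2, h3⟩ := H (f 0) (f 1) (f 2) (f 3) (by simpa [Fin.sum_univ_four] using h)
    intro i
    fin_cases i <;> assumption

theorem LinearIndependent.pair_linear_combination {x y : V} (hxy : LinearIndependent ℝ ![x, y])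
    {p q r s : ℝ} (hdet : p * s - q * r ≠ 0) :
    LinearIndependent ℝ ![p • x + q • y, r • x + s • y] := by
  rw [LinearIndependent.pair_iff] at hxy ⊢
  intro u v h
  obtain ⟨h1, h2⟩ := hxy (u * p + v * r) (u * q + v * s) (by rw [← h]; module)
  constructor
  · exact (mul_eq_zero.1 (show u * (p * s - q * r) = 0 by linear_combination s * h1 - r * h2)
      ).resolve_right hdet
  · exact (mul_eq_zero.1 (show v * (p * s - q * r) = 0 by linear_combination p * h2 - q * h1)
      ).resolve_right hdet

end Independence

/-! ### The Lagrangian plane, its product and its metric -/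

/-- The subspace `h` is an abelian ideal of dimension two, Lagrangian for the symplectic form and
complementary to its image under `J`. The product `x * y = ⁅J x, y⁆` makes it a left-symmetric
algebra. -/
structure KahlerStructure.IsLagrangianPlane {L : Type*} [LieRing L] [LieAlgebra ℝ L]
    (K : KahlerStructure L) (h : Submodule ℝ L) : Prop where
  finrank_total : Module.finrank ℝ L = 4
  finrank_eq : Module.finrank ℝ h = 2
  eq_zero : ∀ x ∈ h, K.J x ∈ h → x = 0
  lie_eq_zero : ∀ x ∈ h, ∀ y ∈ h, ⁅x, y⁆ = 0
  lie_mem : ∀ x : L, ∀ y ∈ h, ⁅x, y⁆ ∈ h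
  isotropic : ∀ x ∈ h, ∀ y ∈ h, K.ω x y = 0

namespace KahlerStructure

variable {L : Type*} [LieRing L] [LieAlgebra ℝ L] {K : KahlerStructure L}

theorem J_injective (K : KahlerStructure L) : Function.Injective K.J := by
  intro x y hxy
  have := congrArg K.J hxy
  rwa [K.J_sq, K.J_sq, neg_inj] at this

/-- The section splits L as ker π ⊕ `k` with ker π = `h`, and the injectivity of J gives both
summands the same dimension, hence 2. -/
theorem IsOrthogonalSplit.isLagrangianPlane (hdim : Module.finrank ℝ L = 4) {h : LieIdeal ℝ L}
    (hab : IsLieAbelian h) (hsplit : K.IsOrthogonalSplit h) :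
    K.IsLagrangianPlane h.toSubmodule := by
  obtain ⟨k, hk, ⟨π, hπ, hsec⟩, horth⟩ := hsplit
  have : FiniteDimensional ℝ L := Module.finite_of_finrank_eq_succ hdim
  have hsec' : ∀ y : k, π y = y := fun y => LieHom.congr_fun hsec y
  have hker : ∀ x, x ∈ h ↔ π x = 0 := fun x => by
    have := (LieHom.range_eq_ker_iff _ _).1 hπ.exact x
    rw [this]
    simp
  have hJ : ∀ x ∈ h, K.J x ∈ k := fun x hx => by
    rw [← LieSubalgebra.mem_toSubmodule, hk]
    exact Submodule.mem_map_of_mem hx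
  have hdisj : ∀ x ∈ h, x ∈ k → x = 0 := fun x hx hxk => by
    have h1 := hsec' ⟨x, hxk⟩
    rw [(hker x).1 hx] at h1
    exact (congrArg Subtype.val h1).symm
  have hcompl : IsCompl h.toSubmodule k.toSubmodule := by
    constructor
    · rw [Submodule.disjoint_def]
      exact hdisj
    · rw [codisjoint_iff, eq_top_iff]
      intro z _
      rw [Submodule.mem_sup]
      refine ⟨z - π z, ?_, π z, (π z).2, by abel⟩
      change z - π z ∈ h
      rw [hker, map_sub, hsec', sub_self]
  have hfin := Submodule.finrank_add_eq_of_isCompl hcompl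
  have hkfin : Module.finrank ℝ k.toSubmodule = Module.finrank ℝ h.toSubmodule := by
    rw [hk]
    exact (LinearEquiv.finrank_eq (Submodule.equivMapOfInjective K.J K.J_injective _)).symm
  refine ⟨hdim, by omega, fun x hx hJx => K.J_injective ?_, fun x hx y hy => ?_,
    fun x y hy => lie_mem_right ℝ L h x y hy, fun x hx y hy => ?_⟩
  · rw [map_zero]
    exact hdisj _ hJx (hJ x hx)
  · exact congrArg Subtype.val (hab.trivial ⟨x, hx⟩ ⟨y, hy⟩)
  -- Isotropy is orthogonality in disguise: g(x, Jy) = ω(Jx, Jy) = ω(x, y).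
  · have := horth x hx (K.J y) (hJ y hy)
    rw [← K.compatible]
    exact this

theorem metric_comm (K : KahlerStructure L) (x y : L) : K.ω (K.J x) y = K.ω (K.J y) x := by
  rw [← K.compatible (K.J x) y, K.J_sq, map_neg, LinearMap.neg_apply, K.alt.neg_eq]

namespace IsLagrangianPlane

variable {h : Submodule ℝ L}

/-- Since [x, y] = 0, the Nijenhuis tensor leaves only [Jx, Jy] = J([Jx, y] + [x, Jy]). -/
theorem lie_J_J (H : K.IsLagrangianPlane h) {x y : L} (hx : x ∈ h) (hy : y ∈ h) :
    ⁅K.J x, K.J y⁆ = K.J (⁅K.J x, y⁆ - ⁅K.J y, x⁆) := by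
  have := K.integrable x y
  rw [H.lie_eq_zero x hx y hy, ← lie_skew x (K.J y), map_neg] at this
  rw [map_sub]
  linear_combination (norm := module) this

theorem exists_coords (H : K.IsLagrangianPlane h) {x y z : L} (hx : x ∈ h) (hy : y ∈ h)
    (hxy : LinearIndependent ℝ ![x, y]) (hz : z ∈ h) : ∃ s t : ℝ, z = s • x + t • y := by
  have hli : LinearIndependent ℝ ![(⟨x, hx⟩ : h), ⟨y, hy⟩] := by
    rw [LinearIndependent.pair_iff] at hxy ⊢
    exact fun s t hst => hxy s t (congrArg Subtype.val hst)
  let b := basisOfLinearIndependentOfCardEqFinrank hli (by simp [H.finrank_eq])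
  have hb : ⇑b = ![(⟨x, hx⟩ : h), ⟨y, hy⟩] := coe_basisOfLinearIndependentOfCardEqFinrank hli _
  have := b.sum_repr ⟨z, hz⟩
  rw [Fin.sum_univ_two, hb] at this
  exact ⟨_, _, (congrArg Subtype.val this).symm⟩

theorem exists_pair (H : K.IsLagrangianPlane h) : ∃ x ∈ h, ∃ y ∈ h, LinearIndependent ℝ ![x, y] := by
  have : Module.Finite ℝ h := Module.finite_of_finrank_eq_succ H.finrank_eq
  let b := Module.finBasisOfFinrankEq ℝ h H.finrank_eq
  refine ⟨b 0, (b 0).2, b 1, (b 1).2, ?_⟩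
  have hb : LinearIndependent ℝ ![b 0, b 1] := by
    convert b.linearIndependent using 1
    ext i
    fin_cases i <;> rfl
  rw [LinearIndependent.pair_iff] at hb ⊢
  exact fun s t hst => hb s t (Subtype.ext hst)

theorem frame (H : K.IsLagrangianPlane h) {x y : L} (hx : x ∈ h) (hy : y ∈ h)
    (hxy : LinearIndependent ℝ ![x, y]) :
    LinearIndependent ℝ ![x, y, K.J x, K.J y] := by
  rw [LinearIndependent.pair_iff] at hxy
  rw [linearIndependent_four_iff]
  intro p q r s hsum
  -- J sends r x + s y to -(p x + q y), which lies in `h`, while `h` and `J h` meet only in 0.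
  have h1 : r • x + s • y = 0 := by
    refine H.eq_zero _ (h.add_mem (h.smul_mem _ hx) (h.smul_mem _ hy)) ?_
    have : K.J (r • x + s • y) = -(p • x + q • y) := by
      rw [map_add, map_smul, map_smul]
      linear_combination (norm := module) hsum
    rw [this]
    exact h.neg_mem (h.add_mem (h.smul_mem _ hx) (h.smul_mem _ hy))
  obtain ⟨rfl, rfl⟩ := hxy r s h1
  obtain ⟨rfl, rfl⟩ := hxy p q (by simpa using hsum)
  simp

/-- The metric restricted to the plane is nondegenerate. -/
theorem metric_nondegenerate (H : K.IsLagrangianPlane h) {x y z : L} (hx : x ∈ h) (hy : y ∈ h)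
    (hz : z ∈ h) (hxy : LinearIndependent ℝ ![x, y]) (hzx : K.ω (K.J z) x = 0) (hzy : K.ω (K.J z) y = 0) :
    z = 0 := by
  refine K.J_injective ?_
  rw [map_zero]
  refine K.nondegenerate.1 _ fun w => ?_
  let b := basisOfLinearIndependentOfCardEqFinrank (H.frame hx hy hxy) (by simp [H.finrank_total])
  have hb : ⇑b = ![x, y, K.J x, K.J y] := coe_basisOfLinearIndependentOfCardEqFinrank _ _
  rw [← b.sum_repr w, Fin.sum_univ_four, hb]
  -- On Jx and Jy the form ω(Jz, ·) vanishes because ω(Jz, Jx) = ω(z, x) and `h` is isotropic.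
  simp [hzx, hzy, K.compatible, H.isotropic z hz x hx, H.isotropic z hz y hy]

/-- Closedness of the symplectic form is the Codazzi equation for the metric. -/
theorem codazzi (H : K.IsLagrangianPlane h) {x y z : L} (hx : x ∈ h) (hy : y ∈ h) :
    K.ω (K.J (⁅K.J x, y⁆ - ⁅K.J y, x⁆)) z =
      K.ω (K.J x) ⁅K.J y, z⁆ - K.ω (K.J y) ⁅K.J x, z⁆ := by
  have := K.closed (K.J x) (K.J y) z
  rw [H.lie_J_J hx hy, ← lie_skew z, map_neg, LinearMap.neg_apply, ← K.alt.neg_eq (K.J _) ⁅K.J y, z⁆,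
    ← K.alt.neg_eq (K.J _) ⁅K.J x, z⁆] at this
  linarith

end IsLagrangianPlane

end KahlerStructure

namespace KahlerStructure.IsLagrangianPlane

variable {L : Type*} [LieRing L] [LieAlgebra ℝ L] {K : KahlerStructure L} {h : Submodule ℝ L}

/-! ### Commutative products: two-dimensional associative algebras -/

section Commutative

variable {x y : L}

theorem lie_J_J_eq_zero (H : K.IsLagrangianPlane h) (hx : x ∈ h) (hy : y ∈ h)
    (hcomm : ⁅K.J x, y⁆ = ⁅K.J y, x⁆) : ⁅K.J x, K.J y⁆ = 0 := by
  rw [H.lie_J_J hx hy, hcomm, sub_self, map_zero]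

theorem nonempty_lieEquiv_of_zero (H : K.IsLagrangianPlane h) (hx : x ∈ h) (hy : y ∈ h)
    (hxy : LinearIndependent ℝ ![x, y]) (h11 : ⁅K.J x, x⁆ = 0) (h12 : ⁅K.J x, y⁆ = 0)
    (h21 : ⁅K.J y, x⁆ = 0) (h22 : ⁅K.J y, y⁆ = 0) : Nonempty (L ≃ₗ⁅ℝ⁆ AbelianLie 4) := by
  refine nonempty_lieEquiv_abelianLie H.finrank_total (H.frame hx hy hxy)
    (H.lie_eq_zero x hx y hy) ?_ ?_ ?_ ?_ (H.lie_J_J_eq_zero hx hy (h12.trans h21.symm)) <;>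
  rw [← lie_skew] <;> simp [*]

theorem nonempty_lieEquiv_of_nilpotent (H : K.IsLagrangianPlane h) (hx : x ∈ h) (hy : y ∈ h)
    (hxy : LinearIndependent ℝ ![x, y]) (h11 : ⁅K.J x, x⁆ = y) (h12 : ⁅K.J x, y⁆ = 0)
    (h21 : ⁅K.J y, x⁆ = 0) (h22 : ⁅K.J y, y⁆ = 0) :
    Nonempty (L ≃ₗ⁅ℝ⁆ (AbelianLie 1 × Heis3)) := by
  have hJ := H.lie_J_J_eq_zero hx hy (h12.trans h21.symm)
  refine nonempty_lieEquiv_abelianLie_prod_heis3 (a := K.J y) (b := K.J x) (c := x) (d := y)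
    H.finrank_total ?_ (by rw [← lie_skew, hJ, neg_zero]) h21 h22 h11 h12 (H.lie_eq_zero x hx y hy)
  have hf := H.frame hx hy hxy
  rw [linearIndependent_four_iff] at hf ⊢
  intro p q r s hs
  obtain ⟨h1, h2, h3, h4⟩ := hf r s q p (by rw [← hs]; module)
  exact ⟨h4, h3, h1, h2⟩

theorem nonempty_lieEquiv_of_idempotent (H : K.IsLagrangianPlane h) (hx : x ∈ h) (hy : y ∈ h)
    (hxy : LinearIndependent ℝ ![x, y]) (h11 : ⁅K.J x, x⁆ = x) (h12 : ⁅K.J x, y⁆ = 0)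
    (h21 : ⁅K.J y, x⁆ = 0) (h22 : ⁅K.J y, y⁆ = 0) :
    Nonempty (L ≃ₗ⁅ℝ⁆ (AbelianLie 2 × Aff ℝ)) := by
  have hJ := H.lie_J_J_eq_zero hx hy (h12.trans h21.symm)
  refine nonempty_lieEquiv_abelianLie_prod_aff (a := K.J y) (b := y) (c := K.J x) (d := x)
    H.finrank_total ?_ h22 (by rw [← lie_skew, hJ, neg_zero]) h21
    (by rw [← lie_skew, h12, neg_zero]) (H.lie_eq_zero y hy x hx) h11
  have hf := H.frame hx hy hxy
  rw [linearIndependent_four_iff] at hf ⊢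
  intro p q r s hs
  obtain ⟨h1, h2, h3, h4⟩ := hf s q r p (by rw [← hs]; module)
  exact ⟨h4, h2, h3, h1⟩

theorem nonempty_lieEquiv_of_two_idempotents (H : K.IsLagrangianPlane h) (hx : x ∈ h) (hy : y ∈ h)
    (hxy : LinearIndependent ℝ ![x, y]) (h11 : ⁅K.J x, x⁆ = x) (h12 : ⁅K.J x, y⁆ = 0)
    (h21 : ⁅K.J y, x⁆ = 0) (h22 : ⁅K.J y, y⁆ = y) :
    Nonempty (L ≃ₗ⁅ℝ⁆ (Aff ℝ × Aff ℝ)) := by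
  have hJ := H.lie_J_J_eq_zero hx hy (h12.trans h21.symm)
  refine nonempty_lieEquiv_aff_prod_aff (a := K.J x) (b := x) (c := K.J y) (d := y)
    H.finrank_total ?_ h11 hJ h12 (by rw [← lie_skew, h21, neg_zero])
    (H.lie_eq_zero x hx y hy) h22
  have hf := H.frame hx hy hxy
  rw [linearIndependent_four_iff] at hf ⊢
  intro p q r s hs
  obtain ⟨h1, h2, h3, h4⟩ := hf q s p r (by rw [← hs]; module)
  exact ⟨h3, h1, h4, h2⟩

theorem nonempty_lieEquiv_of_complex (H : K.IsLagrangianPlane h) (hx : x ∈ h) (hy : y ∈ h)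
    (hxy : LinearIndependent ℝ ![x, y]) (h11 : ⁅K.J x, x⁆ = x) (h12 : ⁅K.J x, y⁆ = y)
    (h21 : ⁅K.J y, x⁆ = y) (h22 : ⁅K.J y, y⁆ = -x) :
    Nonempty (L ≃ₗ⁅ℝ⁆ Aff ℂ) := by
  have hJ := H.lie_J_J_eq_zero hx hy (h12.trans h21.symm)
  refine nonempty_lieEquiv_aff_complex (a := K.J x) (b := K.J y) (c := x) (d := y)
    H.finrank_total ?_ hJ h11 h12 h21 h22 (H.lie_eq_zero x hx y hy)
  have hf := H.frame hx hy hxy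
  rw [linearIndependent_four_iff] at hf ⊢
  intro p q r s hs
  obtain ⟨h1, h2, h3, h4⟩ := hf r s p q (by rw [← hs]; module)
  exact ⟨h3, h4, h1, h2⟩

theorem nonempty_lieEquiv_of_dual_numbers (H : K.IsLagrangianPlane h) (hx : x ∈ h) (hy : y ∈ h)
    (hxy : LinearIndependent ℝ ![x, y]) (h11 : ⁅K.J x, x⁆ = x) (h12 : ⁅K.J x, y⁆ = y)
    (h21 : ⁅K.J y, x⁆ = y) (h22 : ⁅K.J y, y⁆ = 0) :
    Nonempty (L ≃ₗ⁅ℝ⁆ LieD4 1) := by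
  have hJ := H.lie_J_J_eq_zero hx hy (h12.trans h21.symm)
  -- The sign in -Jy turns [x, -Jy] into [Jy, x] = y. The eigenvalues 1, 0, 1 of ad Jx on x, -Jy, y
  -- are those of d_{4,1}.
  refine nonempty_lieEquiv_lieD4 (a := x) (b := -K.J y) (c := y) (d := K.J x)
    H.finrank_total ?_ (by rw [lie_neg, lie_skew, h21]) (H.lie_eq_zero x hx y hy)
    (by rw [h11, one_smul]) (by rw [neg_lie, h22, neg_zero]) (by rw [lie_neg, hJ]; simp) h12
  have hf := H.frame hx hy hxy
  rw [linearIndependent_four_iff] at hf ⊢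
  intro p q r s hs
  obtain ⟨h1, h2, h3, h4⟩ := hf p r s (-q) (by rw [← hs]; module)
  exact ⟨h1, neg_eq_zero.1 h4, h2, h3⟩

/-- The unital case: the plane is spanned by a unit and a square root of a multiple of it. -/
theorem nonempty_lieEquiv_of_unit (H : K.IsLagrangianPlane h) (hx : x ∈ h) (hy : y ∈ h)
    (hxy : LinearIndependent ℝ ![x, y]) {k : ℝ} (h11 : ⁅K.J x, x⁆ = x) (h12 : ⁅K.J x, y⁆ = y)
    (h21 : ⁅K.J y, x⁆ = y) (h22 : ⁅K.J y, y⁆ = k • x) :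
    Nonempty (L ≃ₗ⁅ℝ⁆ Aff ℂ) ∨ Nonempty (L ≃ₗ⁅ℝ⁆ (Aff ℝ × Aff ℝ)) ∨
      Nonempty (L ≃ₗ⁅ℝ⁆ LieD4 1) := by
  rcases lt_trichotomy k 0 with hk | rfl | hk
  · left
    -- With unit x, the element y / r squares to -x and plays the role of i.
    obtain ⟨r, hr, rfl⟩ : ∃ r : ℝ, r ≠ 0 ∧ k = -r ^ 2 :=
      ⟨√(-k), (Real.sqrt_pos.2 (by linarith)).ne', by rw [Real.sq_sqrt (by linarith)]; ring⟩
    refine H.nonempty_lieEquiv_of_complex (x := (1 : ℝ) • x + (0 : ℝ) • y)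
      (y := (0 : ℝ) • x + r⁻¹ • y) (h.add_mem (h.smul_mem _ hx) (h.smul_mem _ hy))
      (h.add_mem (h.smul_mem _ hx) (h.smul_mem _ hy))
      (hxy.pair_linear_combination (by simpa using hr)) ?_ ?_ ?_ ?_ <;>
    simp only [map_add, map_smul, lie_add, add_lie, lie_smul, smul_lie, h11, h12, h21, h22] <;>
    match_scalars <;> field_simp <;> ring
  · exact .inr <| .inr <| H.nonempty_lieEquiv_of_dual_numbers hx hy hxy h11 h12 h21 (by simp [h22])
  · right; left
    obtain ⟨r, hr, rfl⟩ : ∃ r : ℝ, r ≠ 0 ∧ k = r ^ 2 :=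
      ⟨√k, (Real.sqrt_pos.2 hk).ne', by rw [Real.sq_sqrt hk.le]⟩
    -- As y / r squares to the unit x, the elements (x ± y / r) / 2 are orthogonal idempotents.
    refine H.nonempty_lieEquiv_of_two_idempotents (x := (1 / 2 : ℝ) • x + (1 / (2 * r)) • y)
      (y := (1 / 2 : ℝ) • x + (-1 / (2 * r)) • y) (h.add_mem (h.smul_mem _ hx) (h.smul_mem _ hy))
      (h.add_mem (h.smul_mem _ hx) (h.smul_mem _ hy))
      (hxy.pair_linear_combination (by field_simp; norm_num [hr])) ?_ ?_ ?_ ?_ <;>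
    simp only [map_add, map_smul, lie_add, add_lie, lie_smul, smul_lie, h11, h12, h21, h22] <;>
    match_scalars <;> field_simp <;> ring

/-- The case of a commutative product. -/
theorem nonempty_lieEquiv_of_commutative (H : K.IsLagrangianPlane h)
    (hcomm : ∀ x ∈ h, ∀ y ∈ h, ⁅K.J x, y⁆ = ⁅K.J y, x⁆) :
    Nonempty (L ≃ₗ⁅ℝ⁆ AbelianLie 4) ∨ Nonempty (L ≃ₗ⁅ℝ⁆ (AbelianLie 1 × Heis3)) ∨
    Nonempty (L ≃ₗ⁅ℝ⁆ (AbelianLie 2 × Aff ℝ)) ∨ Nonempty (L ≃ₗ⁅ℝ⁆ Aff ℂ) ∨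
    Nonempty (L ≃ₗ⁅ℝ⁆ (Aff ℝ × Aff ℝ)) ∨ Nonempty (L ≃ₗ⁅ℝ⁆ LieD4 1) := by
  -- [Jx, Jy] = 0, so left multiplications commute; with commutativity this is associativity.
  have hassoc : ∀ x ∈ h, ∀ y ∈ h, ∀ z : L, ⁅K.J x, ⁅K.J y, z⁆⁆ = ⁅K.J y, ⁅K.J x, z⁆⁆ := by
    intro x hx y hy z
    have := lie_lie (K.J x) (K.J y) z
    rw [H.lie_J_J_eq_zero hx hy (hcomm x hx y hy), zero_lie] at this
    exact (sub_eq_zero.1 this.symm)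
  by_cases hsq : ∃ x ∈ h, LinearIndependent ℝ ![x, ⁅K.J x, x⁆]
  · obtain ⟨x, hx, hli⟩ := hsq
    obtain ⟨y, h11⟩ : ∃ y, ⁅K.J x, x⁆ = y := ⟨_, rfl⟩
    have hy : y ∈ h := h11 ▸ H.lie_mem _ x hx
    rw [h11] at hli
    obtain ⟨α, β, h12⟩ := H.exists_coords hx hy hli (H.lie_mem (K.J x) y hy)
    have h21 : ⁅K.J y, x⁆ = α • x + β • y := by rw [← hcomm x hx y hy, h12]
    -- Here y = x² and x³ = α x + β x², so this is x⁴ = α x² + β x³.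
    have h22 : ⁅K.J y, y⁆ = (α * β) • x + (α + β ^ 2) • y := by
      nth_rewrite 2 [← h11]
      rw [hassoc y hy x hx, h21, lie_add, lie_smul, lie_smul, h11, h12]
      module
    by_cases hα : α = 0
    · subst hα
      by_cases hβ : β = 0
      · subst hβ
        exact .inr <| .inl <| H.nonempty_lieEquiv_of_nilpotent hx hy hli h11 (by simp [h12])
          (by simp [h21]) (by simp [h22])
      · right; right; left
        -- From x³ = β x²: x² / β² is idempotent and x - x² / β is annihilated by x.
        refine H.nonempty_lieEquiv_of_idempotent (x := (0 : ℝ) • x + (1 / β ^ 2) • y)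
          (y := (1 : ℝ) • x + (-1 / β) • y) (h.add_mem (h.smul_mem _ hx) (h.smul_mem _ hy))
          (h.add_mem (h.smul_mem _ hx) (h.smul_mem _ hy))
          (hli.pair_linear_combination (by simpa using hβ)) ?_ ?_ ?_ ?_ <;>
        simp only [map_add, map_smul, lie_add, add_lie, lie_smul, smul_lie, h11, h12, h21, h22] <;>
        match_scalars <;> field_simp <;> ring
    -- The relation x³ = α x + β x² makes e = (x² - β x) / α a unit. Completing the square, x - (β /
    -- 2) e has square (β² / 4 + α) e.
    · have key := H.nonempty_lieEquiv_of_unit (x := (-β / α) • x + (1 / α) • y)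
          (y := (1 + β ^ 2 / (2 * α)) • x + (-β / (2 * α)) • y) (k := β ^ 2 / 4 + α)
          (h.add_mem (h.smul_mem _ hx) (h.smul_mem _ hy))
          (h.add_mem (h.smul_mem _ hx) (h.smul_mem _ hy))
          (hli.pair_linear_combination (by field_simp; ring_nf; simpa using hα))
      simp only [map_add, map_smul, lie_add, add_lie, lie_smul, smul_lie, h11, h12, h21, h22] at key
      rcases key (by match_scalars <;> field_simp <;> ring) (by match_scalars <;> field_simp <;> ring)
        (by match_scalars <;> field_simp <;> ring) (by match_scalars <;> field_simp <;> ring)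
        with h1 | h1 | h1 <;> simp [h1]
  · left
    push Not at hsq
    have hmul : ∀ x ∈ h, ∃ c : ℝ, ⁅K.J x, x⁆ = c • x := by
      intro x hx
      by_cases hx0 : x = 0
      · exact ⟨0, by simp [hx0]⟩
      · have := hsq x hx
        rw [LinearIndependent.pair_iff' hx0] at this
        push Not at this
        obtain ⟨c, hc⟩ := this
        exact ⟨c, hc.symm⟩
    obtain ⟨x, hx, y, hy, hli⟩ := H.exists_pair
    obtain ⟨a, h11⟩ := hmul x hx
    obtain ⟨b, h22⟩ := hmul y hy
    obtain ⟨c, hc⟩ := hmul (x + y) (h.add_mem hx hy)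
    obtain ⟨d, hd⟩ := hmul (x - y) (h.sub_mem hx hy)
    have h21 := (hcomm x hx y hy).symm
    simp only [map_add, map_sub, lie_add, add_lie, lie_sub, sub_lie, h11, h22, h21] at hc hd
    have hli' := LinearIndependent.pair_iff.1 hli
    -- Every square is now a multiple of its root. Comparing (x + y)² and (x - y)² gives c = a + b,
    -- hence x * y = (b x + a y) / 2; associativity then forces a² = b² = 0.
    obtain ⟨e1, e2⟩ := hli' (2 * a - c - d) (2 * b - c + d)
      (by linear_combination (norm := module) hc + hd)
    have h12 : ⁅K.J x, y⁆ = (b / 2) • x + (a / 2) • y := by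
      have hc' : c = a + b := by linarith
      rw [hc'] at hc
      linear_combination (norm := module) (1 / 2 : ℝ) • hc
    rw [h12] at h21
    have e3 := hassoc x hx y hy x
    have e4 := hassoc y hy x hx y
    simp only [h12, h21, h11, h22, lie_add, lie_smul] at e3 e4
    obtain ⟨-, e5⟩ := hli' (b * a / 2 + a * b / 4 - a * b / 2) (a * a / 4 - a * a / 2)
      (by linear_combination (norm := module) e3)
    obtain ⟨e6, -⟩ := hli' (b * b / 4 - b * b / 2) (b * a / 2 + a * b / 4 - a * b / 2)
      (by linear_combination (norm := module) e4)
    have ha : a = 0 := by nlinarith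
    have hb : b = 0 := by nlinarith
    subst ha hb
    exact H.nonempty_lieEquiv_of_zero hx hy hli (by simp [h11]) (by simp [h12]) (by simp [h21])
      (by simp [h22])

end Commutative

/-! ### Noncommutative products: nilpotency of L_y and the Codazzi equation -/

section Noncommutative

variable {x y : L}

/-- The commutator is alternating on a plane, so its values lie on one line, spanned by w = a * b -
b * a. If w = s a + t b, the commutator of a with w is t w and that of b with w is -s w; one of
these is nonzero and can be rescaled to w. -/
theorem exists_affine_pair (H : K.IsLagrangianPlane h)
    (hcomm : ¬ ∀ x ∈ h, ∀ y ∈ h, ⁅K.J x, y⁆ = ⁅K.J y, x⁆) :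
    ∃ x ∈ h, ∃ y ∈ h, y ≠ 0 ∧ ⁅K.J x, y⁆ - ⁅K.J y, x⁆ = y := by
  push Not at hcomm
  obtain ⟨a, ha, b, hb, hne⟩ := hcomm
  have hli : LinearIndependent ℝ ![a, b] := by
    rw [LinearIndependent.pair_iff]
    intro s t hst
    have hJ : s • K.J a + t • K.J b = 0 := by simpa using congrArg K.J hst
    have h1 : s • (⁅K.J a, b⁆ - ⁅K.J b, a⁆) = 0 := by
      have e1 := congrArg (fun z => ⁅z, b⁆) hJ
      have e2 := congrArg (fun z => ⁅K.J b, z⁆) hst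
      simp only [add_lie, smul_lie, zero_lie, lie_add, lie_smul, lie_zero] at e1 e2
      linear_combination (norm := module) e1 - e2
    have h2 : t • (⁅K.J a, b⁆ - ⁅K.J b, a⁆) = 0 := by
      have e1 := congrArg (fun z => ⁅z, a⁆) hJ
      have e2 := congrArg (fun z => ⁅K.J a, z⁆) hst
      simp only [add_lie, smul_lie, zero_lie, lie_add, lie_smul, lie_zero] at e1 e2
      linear_combination (norm := module) e2 - e1
    have hne' := sub_ne_zero.2 hne
    exact ⟨(smul_eq_zero.1 h1).resolve_right hne', (smul_eq_zero.1 h2).resolve_right hne'⟩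
  obtain ⟨w, hw⟩ : ∃ w, ⁅K.J a, b⁆ - ⁅K.J b, a⁆ = w := ⟨_, rfl⟩
  have hwh : w ∈ h := hw ▸ h.sub_mem (H.lie_mem _ _ hb) (H.lie_mem _ _ ha)
  have hw0 : w ≠ 0 := hw ▸ sub_ne_zero.2 hne
  obtain ⟨s, t, hst⟩ := H.exists_coords ha hb hli hwh
  by_cases ht : t = 0
  · have hs : s ≠ 0 := by
      rintro rfl
      exact hw0 (by simp [hst, ht])
    refine ⟨(-s⁻¹) • b, h.smul_mem _ hb, w, hwh, hw0, ?_⟩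
    have : ⁅K.J b, w⁆ - ⁅K.J w, b⁆ = (-s) • w := by
      rw [hst, ht]
      simp only [map_add, map_smul, lie_add, add_lie, lie_smul, smul_lie]
      rw [ht] at hst
      linear_combination (norm := module) (-s) • hw + (-s) • hst
    rw [map_smul, smul_lie, lie_smul, ← smul_sub, this, smul_smul]
    simp [hs]
  · refine ⟨t⁻¹ • a, h.smul_mem _ ha, w, hwh, hw0, ?_⟩
    have : ⁅K.J a, w⁆ - ⁅K.J w, a⁆ = t • w := by
      rw [hst]
      simp only [map_add, map_smul, lie_add, add_lie, lie_smul, smul_lie]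
      linear_combination (norm := module) t • hw + t • hst
    rw [map_smul, smul_lie, lie_smul, ← smul_sub, this, smul_smul]
    simp [ht]

theorem linearIndependent_of_affine_pair (hne : y ≠ 0) (hbr : ⁅K.J x, y⁆ - ⁅K.J y, x⁆ = y) :
    LinearIndependent ℝ ![x, y] := by
  rw [LinearIndependent.pair_iff]
  intro s t hst
  have hJ : s • K.J x + t • K.J y = 0 := by simpa using congrArg K.J hst
  have e1 := congrArg (fun z => ⁅z, y⁆) hJ
  have e2 := congrArg (fun z => ⁅K.J y, z⁆) hst
  simp only [add_lie, smul_lie, zero_lie, lie_add, lie_smul, lie_zero] at e1 e2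
  have h1 : s • y = 0 := by
    linear_combination (norm := module) e1 - e2 - s • hbr
  have hs := (smul_eq_zero.1 h1).resolve_right hne
  subst hs
  exact ⟨rfl, (smul_eq_zero.1 (by simpa using hst)).resolve_right hne⟩

/-- Codazzi gives g(y, y) = 0 and g(y, x) = -a g(y, x). Nondegeneracy then makes g(y, x) nonzero, so
a = -1. -/
theorem nonempty_lieEquiv_lieR4_of_lie_eq_zero (H : K.IsLagrangianPlane h) (hx : x ∈ h)
    (hy : y ∈ h) (hne : y ≠ 0) (hbr : ⁅K.J x, y⁆ - ⁅K.J y, x⁆ = y) (h21 : ⁅K.J y, x⁆ = 0)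
    (h22 : ⁅K.J y, y⁆ = 0) : Nonempty (L ≃ₗ⁅ℝ⁆ LieR4 (-1) (-1)) := by
  have hli := linearIndependent_of_affine_pair hne hbr
  have h12 : ⁅K.J x, y⁆ = y := by simpa [h21] using hbr
  have hJ : ⁅K.J x, K.J y⁆ = K.J y := by rw [H.lie_J_J hx hy, hbr]
  obtain ⟨a, b, h11⟩ := H.exists_coords hx hy hli (H.lie_mem (K.J x) x hx)
  have c1 := H.codazzi (z := y) hx hy
  have c2 := H.codazzi (z := x) hx hy
  rw [hbr] at c1 c2
  simp only [h21, h22, h12, h11, map_zero, map_add, map_smul, smul_eq_mul] at c1 c2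
  have hyy : K.ω (K.J y) y = 0 := by linarith
  have hyx : K.ω (K.J y) x ≠ 0 := fun hyx => hne (H.metric_nondegenerate hx hy hy hli hyx hyy)
  have ha : a = -1 := mul_right_cancel₀ hyx (by rw [hyy] at c2; linarith)
  subst ha
  -- The shift by (b / 2) y diagonalizes L_x, whose eigenvalues are -1 and 1.
  have h31 : ⁅K.J x, x - (b / 2) • y⁆ = -(x - (b / 2) • y) := by
    rw [lie_sub, lie_smul, h11, h12]
    module
  refine nonempty_lieEquiv_lieR4 (a := x - (b / 2) • y) (b := y) (c := K.J y) (d := -K.J x)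
    H.finrank_total ?_ (H.lie_eq_zero _ (h.sub_mem hx (h.smul_mem _ hy)) y hy) ?_ ?_ ?_ ?_ ?_
  · have hf := H.frame hx hy hli
    rw [linearIndependent_four_iff] at hf ⊢
    intro p q r s hs
    obtain ⟨rfl, h2, h3, h4⟩ := hf p (q - p * (b / 2)) (-s) r (by rw [← hs]; module)
    exact ⟨rfl, by linarith, h4, by linarith⟩
  · rw [← lie_skew, lie_sub, lie_smul, h21, h22]
    simp
  · rw [neg_lie, h31, neg_neg]
  · rw [← lie_skew, h22, neg_zero]
  · rw [neg_lie, h12, neg_one_smul]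
  · rw [neg_lie, hJ, neg_one_smul]

theorem nonempty_lieEquiv_lieD4_two (H : K.IsLagrangianPlane h) (hx : x ∈ h)
    (hy : y ∈ h) (hne : y ≠ 0) (hbr : ⁅K.J x, y⁆ - ⁅K.J y, x⁆ = y) {β : ℝ} (hβ : β ≠ 0)
    (h21 : ⁅K.J y, x⁆ = β • y) (h22 : ⁅K.J y, y⁆ = 0) : Nonempty (L ≃ₗ⁅ℝ⁆ LieD4 2) := by
  have hli := linearIndependent_of_affine_pair hne hbr
  have h12 : ⁅K.J x, y⁆ = (β + 1) • y := by
    rw [h21] at hbr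
    linear_combination (norm := module) hbr
  have hJ : ⁅K.J x, K.J y⁆ = K.J y := by rw [H.lie_J_J hx hy, hbr]
  obtain ⟨a, γ, h11⟩ := H.exists_coords hx hy hli (H.lie_mem (K.J x) x hx)
  have hjac := lie_lie (K.J x) (K.J y) x
  simp only [hJ, h21, h11, h12, lie_add, lie_smul, h22] at hjac
  -- The Jacobi identity on Jx, Jy, x reduces to β (β - a) y = 0.
  have ha : a = β := by
    have : (β * (β - a)) • y = 0 := by linear_combination (norm := module) -hjac
    have := (smul_eq_zero.1 this).resolve_right hne
    linarith [(mul_eq_zero.1 this).resolve_left hβ]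
  subst ha
  have c1 := H.codazzi (z := y) hx hy
  have c2 := H.codazzi (z := x) hx hy
  rw [hbr] at c1 c2
  simp only [h21, h22, h12, h11, map_zero, map_add, map_smul, smul_eq_mul] at c1 c2
  rw [K.metric_comm x y] at c2
  -- Codazzi reads g(y, x) = -γ g(y, y) and (β + 2) g(y, y) = 0. So g(y, y) = 0 would put y in the
  -- radical, and otherwise β = -2.
  have hyy : K.ω (K.J y) y ≠ 0 := fun hyy =>
    hne (H.metric_nondegenerate hx hy hy hli (by rw [hyy] at c2; linarith) hyy)
  have ha : a = -2 := mul_right_cancel₀ hyy (by linarith)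
  subst ha
  refine nonempty_lieEquiv_lieD4 (a := x - γ • y) (b := K.J y) (c := (2 : ℝ) • y) (d := -K.J x)
    H.finrank_total ?_ ?_ ?_ ?_ ?_ ?_ ?_
  · have hf := H.frame hx hy hli
    rw [linearIndependent_four_iff] at hf ⊢
    intro p q r s hs
    obtain ⟨rfl, h2, h3, h4⟩ := hf p (2 * r - p * γ) (-s) q (by rw [← hs]; module)
    exact ⟨rfl, h4, by linarith, by linarith⟩
  · rw [← lie_skew, lie_sub, lie_smul, h21, h22]
    module
  · rw [lie_smul, H.lie_eq_zero _ (h.sub_mem hx (h.smul_mem _ hy)) y hy, smul_zero]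
  · rw [neg_lie, lie_sub, lie_smul, h11, h12]
    module
  · rw [lie_smul, h22, smul_zero]
  · rw [neg_lie, hJ]
    module
  · rw [neg_lie, lie_smul, h12]
    module

theorem nonempty_lieEquiv_lieD4_half (H : K.IsLagrangianPlane h) (hx : x ∈ h)
    (hy : y ∈ h) (hne : y ≠ 0) (hbr : ⁅K.J x, y⁆ - ⁅K.J y, x⁆ = y) {β : ℝ} (hβ : β ≠ 0)
    (h21 : ⁅K.J y, x⁆ = 0) (h22 : ⁅K.J y, y⁆ = β • x) : Nonempty (L ≃ₗ⁅ℝ⁆ LieD4 (1 / 2)) := by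
  have hli := linearIndependent_of_affine_pair hne hbr
  have h12 : ⁅K.J x, y⁆ = y := by simpa [h21] using hbr
  have hJ : ⁅K.J x, K.J y⁆ = K.J y := by rw [H.lie_J_J hx hy, hbr]
  -- This Jacobi identity reads 2 β x = β [Jx, x]. Thus ad Jx has eigenvalues 1, 1, 2 on Jy, y, x,
  -- and halving Jx gives d_{4,1/2}.
  have hjac := lie_lie (K.J x) (K.J y) y
  simp only [hJ, h22, h12, lie_smul] at hjac
  refine nonempty_lieEquiv_lieD4 (a := K.J y) (b := y) (c := β • x) (d := (1 / 2 : ℝ) • K.J x)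
    H.finrank_total ?_ h22 (by rw [lie_smul, h21, smul_zero]) ?_
    (by rw [lie_smul, H.lie_eq_zero y hy x hx, smul_zero]) ?_ ?_
  · have hf := H.frame hx hy hli
    rw [linearIndependent_four_iff] at hf ⊢
    intro p q r s hs
    obtain ⟨h1, h2, h3, h4⟩ := hf (r * β) q (s * (1 / 2)) p (by rw [← hs]; module)
    exact ⟨h4, h2, (mul_eq_zero.1 h1).resolve_right hβ, by linarith⟩
  · rw [smul_lie, hJ]
  · rw [smul_lie, h12]
    module
  · rw [smul_lie, lie_smul]
    linear_combination (norm := module) (-1 / 2 : ℝ) • hjac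

/-- The case of a product that is not commutative. -/
theorem nonempty_lieEquiv_of_noncommutative (H : K.IsLagrangianPlane h)
    (hcomm : ¬ ∀ x ∈ h, ∀ y ∈ h, ⁅K.J x, y⁆ = ⁅K.J y, x⁆) :
    Nonempty (L ≃ₗ⁅ℝ⁆ LieR4 (-1) (-1)) ∨ Nonempty (L ≃ₗ⁅ℝ⁆ LieD4 2) ∨
    Nonempty (L ≃ₗ⁅ℝ⁆ LieD4 (1 / 2)) := by
  obtain ⟨x, hx, y, hy, hne, hbr⟩ := H.exists_affine_pair hcomm
  have hli := linearIndependent_of_affine_pair hne hbr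
  have hJ : ⁅K.J x, K.J y⁆ = K.J y := by rw [H.lie_J_J hx hy, hbr]
  obtain ⟨a₁, a₂, h11⟩ := H.exists_coords hx hy hli (H.lie_mem (K.J x) x hx)
  obtain ⟨b₁, b₂, h21⟩ := H.exists_coords hx hy hli (H.lie_mem (K.J y) x hx)
  obtain ⟨b₃, b₄, h22⟩ := H.exists_coords hx hy hli (H.lie_mem (K.J y) y hy)
  have h12 : ⁅K.J x, y⁆ = b₁ • x + (b₂ + 1) • y := by
    rw [h21] at hbr
    linear_combination (norm := module) hbr
  have jx := lie_lie (K.J x) (K.J y) x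
  have jy := lie_lie (K.J x) (K.J y) y
  simp only [hJ, h11, h21, h22, h12, lie_add, lie_smul] at jx jy
  have hli' := LinearIndependent.pair_iff.1 hli
  -- The operator `⁅J y, ·⁆` equals its commutator with `⁅J x, ·⁆`, hence nilpotent.
  obtain ⟨e11, e21⟩ := hli' (b₁ * a₁ + b₂ * b₁ - a₁ * b₁ - a₂ * b₃ - b₁)
    (b₁ * a₂ + b₂ * (b₂ + 1) - a₁ * b₂ - a₂ * b₄ - b₂)
    (by linear_combination (norm := module) -jx)
  obtain ⟨e12, e22⟩ := hli' (b₃ * a₁ + b₄ * b₁ - b₁ * b₁ - (b₂ + 1) * b₃ - b₃)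
    (b₃ * a₂ + b₄ * (b₂ + 1) - b₁ * b₂ - (b₂ + 1) * b₄ - b₄)
    (by linear_combination (norm := module) -jy)
  -- A commutator has trace zero, so tr L_y = 0.
  have htr : b₄ = -b₁ := by linear_combination -e11 - e22
  subst htr
  -- This is tr(L_y²) = tr(L_y [L_x, L_y]) = 0, up to a factor 2.
  have hdet : b₁ ^ 2 + b₂ * b₃ = 0 := by
    linear_combination (-1 / 2) * (b₁ * e11 + b₃ * e21 + b₂ * e12 - b₁ * e22)
  by_cases h3 : b₃ = 0
  · subst h3
    have h1 : b₁ = 0 := by simpa using hdet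
    subst h1
    have h22' : ⁅K.J y, y⁆ = 0 := by simpa using h22
    by_cases h2 : b₂ = 0
    · subst h2
      exact .inl <| H.nonempty_lieEquiv_lieR4_of_lie_eq_zero hx hy hne hbr (by simpa using h21) h22'
    · exact .inr <| .inl <| H.nonempty_lieEquiv_lieD4_two hx hy hne hbr h2 (by simpa using h21) h22'
  · right; right
    have hb₂ : b₂ = -b₁ ^ 2 / b₃ := by
      rw [eq_div_iff h3]
      linarith
    -- Since L_y² = 0, the vector L_y y / b₃ = x - (b₁ / b₃) y lies in the kernel of L_y. Replacing
    -- x by it changes x by a multiple of y and so preserves the commutator relation.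
    refine H.nonempty_lieEquiv_lieD4_half (x := x - (b₁ / b₃) • y) (y := y) (β := b₃)
      (h.sub_mem hx (h.smul_mem _ hy)) hy hne ?_ h3 ?_ ?_
    · rw [map_sub, map_smul, sub_lie, smul_lie, lie_sub, lie_smul]
      linear_combination (norm := module) hbr
    · rw [lie_sub, lie_smul, h21, h22, hb₂]
      match_scalars <;> field_simp <;> ring
    · rw [h22]
      match_scalars <;> field_simp

end Noncommutative

end KahlerStructure.IsLagrangianPlane

theorem mainTheorem6 {L : Type*} [LieRing L] [LieAlgebra ℝ L]
    (hdim : Module.finrank ℝ L = 4) (K : KahlerStructure L)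
    (h : LieIdeal ℝ L) (hab : IsLieAbelian h) (hsplit : K.IsOrthogonalSplit h) :
    Nonempty (L ≃ₗ⁅ℝ⁆ AbelianLie 4) ∨
    Nonempty (L ≃ₗ⁅ℝ⁆ (AbelianLie 1 × Heis3)) ∨
    Nonempty (L ≃ₗ⁅ℝ⁆ (AbelianLie 2 × Aff ℝ)) ∨
    Nonempty (L ≃ₗ⁅ℝ⁆ Aff ℂ) ∨
    Nonempty (L ≃ₗ⁅ℝ⁆ (Aff ℝ × Aff ℝ)) ∨
    Nonempty (L ≃ₗ⁅ℝ⁆ LieR4 (-1) (-1)) ∨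
    Nonempty (L ≃ₗ⁅ℝ⁆ LieD4 1) ∨
    Nonempty (L ≃ₗ⁅ℝ⁆ LieD4 2) ∨
    Nonempty (L ≃ₗ⁅ℝ⁆ LieD4 (1 / 2)) := by
  have H := hsplit.isLagrangianPlane hdim hab
  by_cases hcomm : ∀ x ∈ h.toSubmodule, ∀ y ∈ h.toSubmodule, ⁅K.J x, y⁆ = ⁅K.J y, x⁆
  · have := H.nonempty_lieEquiv_of_commutative hcomm
    tauto
  · have := H.nonempty_lieEquiv_of_noncommutative hcomm
    tauto
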